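/- For an entire function $f:\mathbb{C}\to\mathbb{C}$, let $CV(f)=\{f(z) : f'(z)=0\}$ be its set of critical values, and let $AV(f)$ be its set of asymptotic values, that is, the set of all $w\in\mathbb{C}$ for which there is a continuous path $\gamma:[0,\infty)\to\mathbb{C}$ with $\gamma(t)\to\infty$ and $f(\gamma(t))\to w$ as $t\to\infty$. The set of singular values of $f$ is $S(f)=\overline{AV(f)\cup CV(f)}$. The function $f$ is called locally univalent if every point of $\mathbb{C}$ has a neighbourhood on which $f$ is injective. Let $\mathcal{E}$ be the class of all entire functions $F_0$ for which there exist entire functions $F_1,F_2,\dots$ and complex numbers $\lambda_1,\lambda_2,\dots$ such that $F_n(z)=\lambda_{n+1}e^{F_{n+1}(z)}$ for all $n\ge 0$ and all $z\in\mathbb{C}$. Theorem. Let $U$ be a closed subset of $\mathbb{C}$ containing $0$ and at least one other point, let $K\subset\mathbb{C}$ be a compact set and let $\varepsilon>0$. Then there exists a locally univalent entire function $f\in\mathcal{E}$ such that $S(f)=U$ and $|f(z)-e^z|\le\varepsilon$ for all $z\in K$. -/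

import Mathlib

open Filter Topology

/-- The set `CV(f)` of critical values: the values `f z` at points `z` with `f' z = 0`
(used for entire functions, so that `deriv` is the genuine derivative). -/
def criticalValues (f : ℂ → ℂ) : Set ℂ :=
  {w | ∃ z : ℂ, deriv f z = 0 ∧ f z = w}

/-- The set `AV(f)` of (finite) asymptotic values: the limits of `f` along paths
`γ : [0, ∞) → ℂ` that tend to infinity. -/
def asymptoticValues (f : ℂ → ℂ) : Set ℂ :=
  {w | ∃ γ : ℝ → ℂ, ContinuousOn γ (Set.Ici 0) ∧ Tendsto γ atTop (cocompact ℂ) ∧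
    Tendsto (fun t => f (γ t)) atTop (𝓝 w)}

/-- The set `S(f)` of singular values: the closure of the union of the asymptotic and the
critical values. -/
def singularValues (f : ℂ → ℂ) : Set ℂ :=
  closure (asymptoticValues f ∪ criticalValues f)

/-- `f` is locally univalent: every point has a neighbourhood on which `f` is injective
(used for entire functions). -/
def LocallyUnivalent (f : ℂ → ℂ) : Prop :=
  ∀ z : ℂ, ∃ V ∈ 𝓝 z, Set.InjOn f V

/-- The class `𝓔` of entire functions `F₀` for which there are entire functions `F₁, F₂, …` and
complex numbers `lam 1, lam 2, …` with `F n = lam (n + 1) * exp (F (n + 1))` for all `n ≥ 0`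
(the number `lam 0` plays no role). -/
def classE : Set (ℂ → ℂ) :=
  {f | ∃ (F : ℕ → ℂ → ℂ) (lam : ℕ → ℂ), F 0 = f ∧ (∀ n, Differentiable ℂ (F n)) ∧
    ∀ n z, F n z = lam (n + 1) * Complex.exp (F (n + 1) z)}

/-!
The function is an infinite composition of exponentials `E_n w = μ n * exp w`: entire functions
`F n` with `F n = E_n ∘ F (n + 1)`, and `f = F 0`. Membership in `classE` is then immediate.

*Choice of `μ`.* The finite compositions `E_0 ∘ ⋯ ∘ E_{n-1}` (`expTower μ n`) map `ℂ \ {0}` onto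
`ℂ \ {0}`, so the points `E_0 ∘ ⋯ ∘ E_n (0) = expTower μ n (μ n)` can be made to run through any
sequence of nonzero numbers (`exists_expTower_eq`); a dense sequence in `U \ {0}` is taken.

*Convergence.* For any such `μ` the tower exists (`exists_tower`). The map `E_n` is almost
affine where its values are large: if `μ n * exp b' = b`, then
`E_n (b' + (c / b) * z) = b * exp (c * z / b)`, which is close to `b + c * z` when `b` is large.
Logarithms being determined only up to `2 * π * I`, the numbers `b n` with
`μ n * exp (b (n + 1)) = b n` can successively be chosen as large as needed. Starting from
`b 0 = c 0 = 1` the finite towers `E_0 ∘ ⋯ ∘ E_{n-1} (b n + c n * z)`, of which the one for `n = 1`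
is `exp`, converge, the limit is close to `exp` on a given disc, and `F n` is close to the affine
map `b n + c n * z` on a disc of radius `n`, with an error small relative to `c n`.

*Critical points.* A critical point of `f` would be a critical point of every `F n`, which
Cauchy's estimate for `F n - (b n + c n * z)` excludes (`deriv_tower_ne_zero`).

*Asymptotic values, lower bound.* Each `F n` is zero-free, so by Iversen's theorem for `1 / F n`
(`exists_path_tendsto_norm_atTop`) it tends to `0` along a path to infinity. Hence all the points
`expTower μ n 0` are asymptotic values of `f`, and they are dense in `U`.

*Asymptotic values, upper bound* (`mem_of_tendsto_tower`). If `f` tends to `w ∉ U` along a path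
`γ`, take a disc `V` about a point `f (γ t₀)` near `w` that contains no point `expTower μ n 0`.
Successive logarithms give holomorphic `g n` on `V` with `g n (f (γ t)) = F n (γ t)`. The maps
`φ n = (g n - b n) / c n` omit a fixed disc, namely one that `f` maps outside `V`, hence are
uniformly bounded on a smaller disc (Borel–Carathéodory). But `φ n (f (γ t))` tends to `γ t`, so
`γ` would be bounded.
-/

/-! ### Finite exponential towers -/

/-- The composition `E₀ ∘ E₁ ∘ ⋯ ∘ Eₙ₋₁` of the maps `Eᵢ w = μ i * exp w`. -/
noncomputable def expTower (μ : ℕ → ℂ) : ℕ → ℂ → ℂ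
  | 0, w => w
  | n + 1, w => expTower μ n (μ n * Complex.exp w)

theorem expTower_succ_left (μ : ℕ → ℂ) (n : ℕ) (w : ℂ) :
    expTower μ (n + 1) w = μ 0 * Complex.exp (expTower (fun i => μ (i + 1)) n w) := by
  induction n generalizing w with
  | zero => rfl
  | succ n ih => exact ih (μ (n + 1) * Complex.exp w)

theorem differentiable_expTower (μ : ℕ → ℂ) (n : ℕ) : Differentiable ℂ (expTower μ n) := by
  induction n with
  | zero => exact differentiable_id
  | succ n ih => exact ih.comp (Complex.differentiable_exp.const_mul (μ n))

theorem expTower_eq_of_recursion {α : Type*} {μ : ℕ → ℂ} {F : ℕ → α → ℂ} {z : α}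
    (hF : ∀ n, F n z = μ n * Complex.exp (F (n + 1) z)) (n : ℕ) :
    expTower μ n (F n z) = F 0 z := by
  induction n with
  | zero => rfl
  | succ n ih => rw [← ih, hF n]; rfl

/-- The solutions of `a * exp w = v` are unbounded, so one of them satisfies any property that
holds outside a compact set. -/
theorem exists_mul_exp_eq_of_eventually_cocompact {a v : ℂ} (ha : a ≠ 0) (hv : v ≠ 0)
    {p : ℂ → Prop} (hp : ∀ᶠ w in cocompact ℂ, p w) : ∃ w, a * Complex.exp w = v ∧ p w := by
  have hnorm : Tendsto (fun k : ℕ => ‖(k : ℂ) * (2 * Real.pi * Complex.I)‖) atTop atTop := by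
    have h2 : Tendsto (fun k : ℕ => (k : ℝ) * (2 * Real.pi)) atTop atTop :=
      tendsto_natCast_atTop_atTop.atTop_mul_const (by positivity)
    refine h2.congr fun k => ?_
    simp [abs_of_pos Real.pi_pos]
  have h := (tendsto_cocompact_of_tendsto_dist_comp_atTop (-Complex.log (v / a))
    (f := fun k : ℕ => Complex.log (v / a) + (k : ℂ) * (2 * Real.pi * Complex.I)) (l := atTop) ?_)
  · obtain ⟨k, hk⟩ := (h.eventually hp).exists
    refine ⟨_, ?_, hk⟩
    rw [Complex.exp_add, Complex.exp_log (div_ne_zero hv ha),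
      Complex.exp_nat_mul_two_pi_mul_I, mul_one, mul_div_cancel₀ _ ha]
  · refine tendsto_atTop_mono (fun k => ?_) (tendsto_atTop_add_const_right _
      (-(2 * ‖Complex.log (v / a)‖)) hnorm)
    rw [dist_eq_norm]
    have := norm_sub_le (Complex.log (v / a) + (k : ℂ) * (2 * Real.pi * Complex.I)
      - -Complex.log (v / a)) (2 * Complex.log (v / a))
    have e : Complex.log (v / a) + (k : ℂ) * (2 * Real.pi * Complex.I)
      - -Complex.log (v / a) - 2 * Complex.log (v / a) = (k : ℂ) * (2 * Real.pi * Complex.I) := by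
      ring
    rw [e, norm_mul 2, Complex.norm_ofNat] at this
    linarith

/-- The values `expTower μ n (μ n) = expTower μ (n + 1) 0` can be prescribed arbitrarily in
`ℂ \ {0}`, because every composition of maps `w ↦ a * exp w`, `a ≠ 0`, maps `ℂ \ {0}` onto
`ℂ \ {0}`. -/
theorem exists_expTower_eq (d : ℕ → ℂ) (hd : ∀ n, d n ≠ 0) :
    ∃ μ : ℕ → ℂ, (∀ n, μ n ≠ 0) ∧ ∀ n, expTower μ n (μ n) = d n := by
  let S := {E : ℂ → ℂ // ∀ v, v ≠ 0 → ∃ w, w ≠ 0 ∧ E w = v}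
  have hpre : ∀ (E : S) (n : ℕ), ∃ w, w ≠ 0 ∧ E.1 w = d n := fun E n => E.2 _ (hd n)
  choose x hx0 hx using hpre
  let next : ℕ → S → S := fun n E => ⟨fun w => E.1 (x E n * Complex.exp w), fun v hv => by
    obtain ⟨u, hu, huv⟩ := E.2 v hv
    obtain ⟨w, hw, hw0⟩ := exists_mul_exp_eq_of_eventually_cocompact (hx0 E n) hu
      (show ∀ᶠ w in cocompact ℂ, w ≠ 0 from isCompact_singleton.compl_mem_cocompact)
    exact ⟨w, hw0, by simp only [hw, huv]⟩⟩
  let E : ℕ → S := fun n => Nat.rec ⟨id, fun v hv => ⟨v, hv, rfl⟩⟩ next n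
  have hE : ∀ n, expTower (fun n => x (E n) n) n = (E n).1 := by
    intro n
    induction n with
    | zero => rfl
    | succ n ih =>
      funext w
      change expTower _ n _ = _
      rw [ih]
  refine ⟨fun n => x (E n) n, fun n => hx0 _ _, fun n => ?_⟩
  rw [hE]
  exact hx _ _

/-! ### Convergence of infinite towers -/

/-- As `b → ∞`, the maps `z ↦ b * (exp (c * z / b) - 1)` tend to `z ↦ c * z` uniformly on bounded
sets, also after composition with a continuous map. -/
theorem eventually_norm_comp_mul_exp_sub_le {Q : ℂ → ℂ} (hQ : Continuous Q) (c : ℂ) (R : ℝ)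
    {τ : ℝ} (hτ : 0 < τ) : ∀ᶠ b in cocompact ℂ, ∀ z : ℂ, ‖z‖ ≤ R →
      ‖Q (b * (Complex.exp (c * z / b) - 1)) - Q (c * z)‖ ≤ τ := by
  have hK := isCompact_closedBall (0 : ℂ) (‖c‖ * R + 1)
  obtain ⟨δ, hδ, hQδ⟩ := Metric.uniformContinuousOn_iff.1
    (hK.uniformContinuousOn_of_continuous hQ.continuousOn) τ hτ
  have hlim : Tendsto (fun b : ℂ => (‖c‖ * R) ^ 2 / ‖b‖) (cocompact ℂ) (𝓝 0) :=
    (tendsto_norm_cocompact_atTop (E := ℂ)).const_div_atTop _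
  filter_upwards [hlim.eventually (gt_mem_nhds (lt_min hδ one_pos)),
    (tendsto_norm_cocompact_atTop (E := ℂ)).eventually_ge_atTop (‖c‖ * R),
    (tendsto_norm_cocompact_atTop (E := ℂ)).eventually_gt_atTop 0] with b hb1 hb2 hb3 z hz
  have hcz : ‖c * z‖ ≤ ‖c‖ * R := by
    rw [norm_mul]; gcongr
  have hb0 : b ≠ 0 := norm_pos_iff.1 hb3
  have hx : ‖c * z / b‖ ≤ 1 := by
    rw [norm_div, div_le_one hb3]; linarith
  have hd : ‖b * (Complex.exp (c * z / b) - 1) - c * z‖ < min δ 1 := by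
    refine lt_of_le_of_lt ?_ hb1
    have e : b * (Complex.exp (c * z / b) - 1) - c * z
        = b * (Complex.exp (c * z / b) - 1 - c * z / b) := by
      field_simp
    rw [e, norm_mul]
    calc ‖b‖ * ‖Complex.exp (c * z / b) - 1 - c * z / b‖
        ≤ ‖b‖ * ‖c * z / b‖ ^ 2 := by
          gcongr; exact Complex.norm_exp_sub_one_sub_id_le hx
      _ = ‖c * z‖ ^ 2 / ‖b‖ := by rw [norm_div]; field_simp
      _ ≤ _ := by gcongr
  have hd1 := hd.trans_le (min_le_right _ _)
  rw [← dist_eq_norm]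
  refine (hQδ _ ?_ _ ?_ ?_).le
  · rw [mem_closedBall_zero_iff]
    have := norm_le_norm_add_norm_sub (c * z) (b * (Complex.exp (c * z / b) - 1))
    linarith [norm_sub_rev (c * z) (b * (Complex.exp (c * z / b) - 1))]
  · rw [mem_closedBall_zero_iff]; linarith
  · rw [dist_eq_norm]; exact hd.trans_le (min_le_left _ _)

/-- The inductive choice of the affine maps `z ↦ b n + c n * z` that the members of the tower are
modelled on. Among the solutions `b (n + 1)` of `μ n * exp (b (n + 1)) = b n` one is taken so large
that replacing `b (n + 1) + c (n + 1) * z` by `μ (n + 1) * exp (b (n + 2) + c (n + 2) * z)`, which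
does not depend on the choice of `b (n + 2)`, changes the finitely many compositions
`E_m ∘ ⋯ ∘ E_n` by at most `τ (n + 1)`. -/
theorem exists_affine_models (μ : ℕ → ℂ) (hμ : ∀ n, μ n ≠ 0) (R ε : ℝ) (hε : 0 < ε) :
    ∃ (b c : ℕ → ℂ) (τ : ℕ → ℝ), b 0 = 1 ∧ c 0 = 1 ∧ (∀ n, c n ≠ 0) ∧
      (∀ n, τ (n + 1) ≤ τ n / 2) ∧ (∀ n, 2 * τ (n + 1) ≤ ‖c (n + 1)‖ * ε / 2 ^ (n + 1)) ∧
      (∀ n, c (n + 1) = c n / b n) ∧ (∀ n, μ n * Complex.exp (b (n + 1)) = b n) ∧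
      ∀ n m j : ℕ, m + j = n + 1 → ∀ z : ℂ, ‖z‖ ≤ R + (n + 1) →
        ‖expTower (fun i => μ (m + i)) j
            (b (n + 1) * Complex.exp (c (n + 1) * z / b (n + 1))) -
          expTower (fun i => μ (m + i)) j (b (n + 1) + c (n + 1) * z)‖ ≤ τ (n + 1) := by
  have step : ∀ (n : ℕ) (b c : ℂ) (τ : ℝ), b ≠ 0 → 0 < τ → ∃ b' : ℂ, b' ≠ 0 ∧
      μ n * Complex.exp b' = b ∧ ∀ m j : ℕ, m + j = n + 1 → ∀ z : ℂ, ‖z‖ ≤ R + (n + 1) →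
        ‖expTower (fun i => μ (m + i)) j (b' * Complex.exp (c * z / b')) -
          expTower (fun i => μ (m + i)) j (b' + c * z)‖ ≤ τ := by
    intro n b c τ hb hτ
    have hev : ∀ᶠ b' in cocompact ℂ, b' ≠ 0 ∧ (∀ z : ℂ, ‖z‖ ≤ R + (n + 1) →
        ‖b' * (Complex.exp (c * z / b') - 1) - c * z‖ ≤ τ) ∧
        ∀ p ∈ Finset.HasAntidiagonal.antidiagonal n, ∀ z : ℂ, ‖z‖ ≤ R + (n + 1) →
          ‖expTower (fun i => μ (p.1 + i)) p.2
              (b * Complex.exp (b' * (Complex.exp (c * z / b') - 1))) -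
            expTower (fun i => μ (p.1 + i)) p.2 (b * Complex.exp (c * z))‖ ≤ τ := by
      refine (show ∀ᶠ w in cocompact ℂ, w ≠ 0 from isCompact_singleton.compl_mem_cocompact).and
        ((eventually_norm_comp_mul_exp_sub_le continuous_id c _ hτ).and
          ((eventually_all_finset _).2 fun p _ => ?_))
      refine eventually_norm_comp_mul_exp_sub_le (Q := fun u =>
        expTower (fun i => μ (p.1 + i)) p.2 (b * Complex.exp u)) ?_ c _ hτ
      exact (differentiable_expTower _ _).continuous.comp (by fun_prop)
    obtain ⟨b', hexp, hb', hid, hall⟩ :=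
      exists_mul_exp_eq_of_eventually_cocompact (hμ n) hb hev
    refine ⟨b', hb', hexp, fun m j hmj z hz => ?_⟩
    cases j with
    | zero =>
      have e : b' * Complex.exp (c * z / b') - (b' + c * z)
          = b' * (Complex.exp (c * z / b') - 1) - c * z := by ring
      change ‖b' * Complex.exp (c * z / b') - (b' + c * z)‖ ≤ τ
      rw [e]
      exact hid z hz
    | succ j =>
      have hmj' : m + j = n := by omega
      have key := hall (m, j) (by simpa using hmj') z hz
      have e : b' * Complex.exp (c * z / b') = b' + b' * (Complex.exp (c * z / b') - 1) := by ring
      change ‖expTower (fun i => μ (m + i)) j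
          (μ (m + j) * Complex.exp (b' * Complex.exp (c * z / b'))) -
        expTower (fun i => μ (m + i)) j (μ (m + j) * Complex.exp (b' + c * z))‖ ≤ τ
      rw [e, Complex.exp_add, Complex.exp_add, hmj', ← mul_assoc, ← mul_assoc, hexp]
      exact key
  let St := {s : ℂ × ℂ × ℝ // s.1 ≠ 0 ∧ s.2.1 ≠ 0 ∧ 0 < s.2.2}
  have hstep : ∀ (n : ℕ) (s : St), ∃ s' : St, s'.1.2.2 ≤ s.1.2.2 / 2 ∧
      2 * s'.1.2.2 ≤ ‖s'.1.2.1‖ * ε / 2 ^ (n + 1) ∧ s'.1.2.1 = s.1.2.1 / s.1.1 ∧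
      μ n * Complex.exp s'.1.1 = s.1.1 ∧
      ∀ m j : ℕ, m + j = n + 1 → ∀ z : ℂ, ‖z‖ ≤ R + (n + 1) →
        ‖expTower (fun i => μ (m + i)) j (s'.1.1 * Complex.exp (s'.1.2.1 * z / s'.1.1)) -
          expTower (fun i => μ (m + i)) j (s'.1.1 + s'.1.2.1 * z)‖ ≤ s'.1.2.2 := by
    rintro n ⟨⟨b, c, τ⟩, hb, hc, hτ⟩
    simp only at hb hc hτ
    have hc' : c / b ≠ 0 := div_ne_zero hc hb
    have hτ' : 0 < min (τ / 2) (‖c / b‖ * ε / 2 ^ (n + 1) / 2) :=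
      lt_min (half_pos hτ) (by have := norm_pos_iff.2 hc'; positivity)
    obtain ⟨b', hb', h1, h2⟩ := step n b (c / b) _ hb hτ'
    refine ⟨⟨⟨b', c / b, _⟩, hb', hc', hτ'⟩, min_le_left _ _, ?_, rfl, h1, h2⟩
    have := min_le_right (τ / 2) (‖c / b‖ * ε / 2 ^ (n + 1) / 2)
    simp only
    linarith
  choose next hnext using hstep
  let s : ℕ → St := fun n =>
    Nat.rec ⟨⟨1, 1, 1⟩, one_ne_zero, one_ne_zero, one_pos⟩ (fun n s => next n s) n
  have hs : ∀ n, s (n + 1) = next n (s n) := fun n => rfl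
  refine ⟨fun n => (s n).1.1, fun n => (s n).1.2.1, fun n => (s n).1.2.2, rfl, rfl,
    fun n => (s n).2.2.1, fun n => (hnext n (s n)).1,
    fun n => (hnext n (s n)).2.1, fun n => (hnext n (s n)).2.2.1,
    fun n => (hnext n (s n)).2.2.2.1, fun n => (hnext n (s n)).2.2.2.2⟩

/-- An infinite composition of the maps `w ↦ μ n * exp w` that starts close to `exp` and whose
`n`-th tail is, on a disc of radius at least `n`, almost the affine map `z ↦ b n + c n * z`. -/
theorem exists_tower (μ : ℕ → ℂ) (hμ : ∀ n, μ n ≠ 0) (R ε : ℝ) (hR : 0 ≤ R) (hε : 0 < ε) :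
    ∃ (F : ℕ → ℂ → ℂ) (b c : ℕ → ℂ), (∀ n, Differentiable ℂ (F n)) ∧
      (∀ n z, F n z = μ n * Complex.exp (F (n + 1) z)) ∧
      (∀ z : ℂ, ‖z‖ ≤ R → ‖F 0 z - Complex.exp z‖ ≤ ε) ∧ (∀ n, c n ≠ 0) ∧
      ∀ (n : ℕ) (z : ℂ), n ≠ 0 → ‖z‖ ≤ n → ‖F n z - (b n + c n * z)‖ ≤ ‖c n‖ * ε / 2 ^ n := by
  obtain ⟨b, c, τ, hb0, hc0, hc, hτ, hτc, hcb, hexp, hclose⟩ :=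
    exists_affine_models μ hμ R ε hε
  let A : ℕ → ℕ → ℂ → ℂ := fun m j z =>
    expTower (fun i => μ (m + i)) j (b (m + j) + c (m + j) * z)
  have hA : ∀ m j z, A m (j + 1) z = expTower (fun i => μ (m + i)) j
      (b (m + j) * Complex.exp (c (m + j) * z / b (m + j))) := by
    intro m j z
    change expTower (fun i => μ (m + i)) j
      (μ (m + j) * Complex.exp (b (m + j + 1) + c (m + j + 1) * z)) = _
    rw [Complex.exp_add, ← mul_assoc, hexp, hcb, div_mul_eq_mul_div]
  have hdist : ∀ m j, m + j ≠ 0 → ∀ z : ℂ, ‖z‖ ≤ R + (m + j : ℕ) →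
      dist (A m j z) (A m (j + 1) z) ≤ τ (m + j) := by
    intro m j hmj z hz
    obtain ⟨n, hn⟩ := Nat.exists_eq_succ_of_ne_zero hmj
    rw [dist_comm, dist_eq_norm, hA]
    have := hclose n m j hn z (by rw [hn] at hz; exact_mod_cast hz)
    simpa only [A, hn] using this
  have hτpow : ∀ k i, τ (k + i) ≤ τ k / 2 ^ i := by
    intro k i
    induction i with
    | zero => simp
    | succ i ih =>
      have := hτ (k + i)
      rw [pow_succ, ← div_div]
      exact this.trans (by linarith)
  have hgeo : ∀ m J, m + J ≠ 0 → ∀ z : ℂ, ‖z‖ ≤ R + (m + J : ℕ) →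
      ∀ i, dist (A m (i + J) z) (A m (i + 1 + J) z) ≤ 2 * τ (m + J) / 2 / 2 ^ i := by
    intro m J hmJ z hz i
    have h1 := hdist m (i + J) (by omega) z
      (hz.trans (by push_cast; linarith [i.cast_nonneg (α := ℝ)]))
    have h2 := hτpow (m + J) i
    rw [show m + J + i = m + (i + J) by omega] at h2
    rw [show i + 1 + J = i + J + 1 by omega, mul_div_cancel_left₀ _ two_ne_zero]
    exact h1.trans h2
  have hlim : ∀ m z, ∃ w, Tendsto (fun j => A m j z) atTop (𝓝 w) := by
    intro m z
    obtain ⟨J, hJ⟩ := exists_nat_ge ‖z‖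
    obtain ⟨w, hw⟩ := cauchySeq_tendsto_of_complete (cauchySeq_of_le_geometric_two
      (hgeo m (J + 1) (by omega) z (by push_cast; linarith [m.cast_nonneg (α := ℝ)])))
    exact ⟨w, (tendsto_add_atTop_iff_nat (J + 1)).1 hw⟩
  choose F hF using hlim
  have hFA : ∀ m J, m + J ≠ 0 → ∀ z : ℂ, ‖z‖ ≤ R + (m + J : ℕ) →
      ‖F m z - A m J z‖ ≤ 2 * τ (m + J) := by
    intro m J hmJ z hz
    have := dist_le_of_le_geometric_two_of_tendsto₀ (hgeo m J hmJ z hz)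
      ((tendsto_add_atTop_iff_nat J).2 (hF m z))
    rw [dist_comm, dist_eq_norm] at this
    simpa using this
  have hτ0 : Tendsto τ atTop (𝓝 0) := by
    have hpos : ∀ n, 0 ≤ τ (n + 1) := fun n =>
      dist_nonneg.trans (hdist 0 (n + 1) (by omega) 0 (by rw [norm_zero]; positivity) |>.trans_eq
        (by rw [zero_add]))
    rw [← tendsto_add_atTop_iff_nat 1]
    refine squeeze_zero hpos (fun n => (add_comm n 1 ▸ hτpow 1 n)) ?_
    exact tendsto_const_nhds.div_atTop (tendsto_pow_atTop_atTop_of_one_lt one_lt_two)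
  refine ⟨F, b, c, fun m => ?_, fun m z => ?_, fun z hz => ?_, hc, fun n z hn hz => ?_⟩
  · rw [← differentiableOn_univ]
    refine TendstoLocallyUniformlyOn.differentiableOn (F := A m) (φ := atTop) ?_
      (Eventually.of_forall fun j => ?_) isOpen_univ
    · rw [tendstoLocallyUniformlyOn_iff_forall_isCompact isOpen_univ]
      intro K _ hK
      obtain ⟨r, hr⟩ := hK.isBounded.exists_norm_le
      rw [Metric.tendstoUniformlyOn_iff]
      intro η hη
      have h1 : Tendsto (fun j => 2 * τ (m + j)) atTop (𝓝 0) := by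
        simpa using (hτ0.comp (tendsto_add_atTop_nat m)).const_mul 2 |>.congr
          fun j => by rw [Function.comp_apply, add_comm]
      obtain ⟨N, hN⟩ := exists_nat_ge r
      filter_upwards [h1.eventually (gt_mem_nhds hη), eventually_ge_atTop (N + 1)] with j hj hjN z hz
      rw [dist_eq_norm]
      refine (hFA m j (by omega) z ((hr z hz).trans (hN.trans ?_))).trans_lt hj
      have : (N : ℝ) ≤ (m + j : ℕ) := by exact_mod_cast (by omega : N ≤ m + j)
      linarith
    · exact ((differentiable_expTower _ _).comp (by fun_prop :
        Differentiable ℂ fun z => b (m + j) + c (m + j) * z)).differentiableOn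
  · have h1 : Tendsto (fun j => A m (j + 1) z) atTop (𝓝 (F m z)) :=
      (tendsto_add_atTop_iff_nat 1).2 (hF m z)
    have h2 : Tendsto (fun j => μ m * Complex.exp (A (m + 1) j z)) atTop
        (𝓝 (μ m * Complex.exp (F (m + 1) z))) :=
      ((Complex.continuous_exp.tendsto _).comp (hF (m + 1) z)).const_mul _
    refine tendsto_nhds_unique h1 (h2.congr fun j => ?_)
    simp only [A]
    rw [expTower_succ_left]
    simp only [add_zero, show ∀ i, m + 1 + i = m + (i + 1) from fun i => by omega]
  · have h := hFA 0 1 one_ne_zero z (by push_cast; linarith)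
    rw [hA] at h
    have h2 := hτc 0
    have hc1 : c 1 = 1 := by rw [hcb, hc0, hb0, div_one]
    simp only [zero_add, hc1, norm_one, one_mul, pow_one] at h2
    simp only [expTower, add_zero, hb0, hc0, one_mul, div_one, zero_add] at h
    linarith
  · have h := hFA n 0 (by omega) z (hz.trans (by simp [hR]))
    obtain ⟨k, rfl⟩ := Nat.exists_eq_succ_of_ne_zero hn
    exact h.trans (hτc k)

/-! ### Iversen's theorem -/

/-- Paths joining consecutive terms of a sequence can be run through one after the other. -/
theorem exists_continuous_concat {E : Type*} [NormedAddCommGroup E] [NormedSpace ℝ E] {z : ℕ → E}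
    (p : ∀ n, Path (z n) (z (n + 1))) :
    ∃ γ : ℝ → E, Continuous γ ∧ ∀ t, 0 ≤ t → γ t ∈ Set.range (p ⌊t⌋₊) := by
  -- The `k`-th summand is constant before time `k`, where it is `0`, and after time `k + 1`.
  let Γ : ℕ → ℝ → E := fun N t => z 0 + ∑ k ∈ Finset.range N, ((p k).extend (t - k) - z k)
  have hsucc : ∀ N t, Γ (N + 1) t = Γ N t + ((p N).extend (t - N) - z N) := fun N t => by
    simp only [Γ, Finset.sum_range_succ, add_assoc]
  have hstab : ∀ (N M : ℕ) (t : ℝ), t ≤ N → N ≤ M → Γ M t = Γ N t := by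
    intro N M t ht hNM
    induction M, hNM using Nat.le_induction with
    | base => rfl
    | succ M hM ih =>
      have : t - M ≤ 0 := by
        have : (N : ℝ) ≤ M := by exact_mod_cast hM
        linarith
      rw [hsucc, ih, (p M).extend_of_le_zero this, sub_self, add_zero]
  have hend : ∀ (N : ℕ) (t : ℝ), N ≤ t → Γ N t = z N := by
    intro N
    induction N with
    | zero => intro t _; simp [Γ]
    | succ N ih =>
      intro t ht
      push_cast at ht
      rw [hsucc, ih t (by linarith), (p N).extend_of_one_le (by linarith)]
      abel
  have hcont : ∀ N, Continuous (Γ N) := fun N => by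
    refine continuous_const.add (continuous_finsetSum _ fun k _ => ?_)
    exact ((p k).continuous_extend.comp (by fun_prop)).sub continuous_const
  refine ⟨fun t => Γ (⌊t⌋₊ + 1) t, continuous_iff_continuousAt.2 fun t => ?_, fun t ht => ?_⟩
  · refine ((hcont (⌊t⌋₊ + 1)).continuousAt).congr ?_
    filter_upwards [Iio_mem_nhds (Nat.lt_floor_add_one t)] with s hs
    have hs' : s < (⌊t⌋₊ + 1 : ℕ) := by exact_mod_cast hs
    have h1 : ⌊s⌋₊ + 1 ≤ ⌊t⌋₊ + 1 := Nat.succ_le_of_lt (Nat.floor_lt' (by omega) |>.2 hs')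
    exact hstab _ _ s (by exact_mod_cast (Nat.lt_floor_add_one s).le) h1
  · change Γ (⌊t⌋₊ + 1) t ∈ _
    rw [hsucc, hend _ _ (Nat.floor_le ht), add_sub_cancel, ← (p ⌊t⌋₊).extend_range]
    exact Set.mem_range_self _

theorem norm_le_of_mem_frontier_connectedComponentIn {g : ℂ → ℂ} (hg : Continuous g) {r : ℝ}
    {z₀ z : ℂ} (hz : z ∈ frontier (connectedComponentIn {z | r < ‖g z‖} z₀)) : ‖g z‖ ≤ r := by
  by_contra! h
  have hS : IsOpen {z | r < ‖g z‖} := isOpen_lt continuous_const hg.norm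
  have hopen : IsOpen (connectedComponentIn {z | r < ‖g z‖} z₀) := hS.connectedComponentIn
  obtain ⟨y, hy, hy0⟩ := mem_closure_iff.1 (frontier_subset_closure hz)
    (connectedComponentIn {z | r < ‖g z‖} z) hS.connectedComponentIn (mem_connectedComponentIn h)
  rw [hopen.frontier_eq] at hz
  refine hz.2 ?_
  rw [connectedComponentIn_eq hy0, ← connectedComponentIn_eq hy]
  exact mem_connectedComponentIn h

/-- An entire function is unbounded on each component of `{r < ‖g‖}`, provided that it takes a
value of modulus less than `r`. This is the Phragmén–Lindelöf principle for a domain that omits a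
neighbourhood of the point `a`: the maximum principle is applied to `g ^ m / (z - a)`, and then
`m` tends to infinity. -/
theorem exists_lt_norm_of_mem_connectedComponentIn {g : ℂ → ℂ} (hg : Differentiable ℂ g) {r : ℝ}
    {a z₀ : ℂ} (ha : ‖g a‖ < r) (hz₀ : r < ‖g z₀‖) (M : ℝ) :
    ∃ z ∈ connectedComponentIn {z | r < ‖g z‖} z₀, M < ‖g z‖ := by
  by_contra! hM
  set D := connectedComponentIn {z | r < ‖g z‖} z₀ with hD
  have hr : 0 < r := (norm_nonneg _).trans_lt ha
  have hz₀D : z₀ ∈ D := mem_connectedComponentIn hz₀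
  have hM0 : 0 ≤ M := (norm_nonneg _).trans (hM z₀ hz₀D)
  have hMcl : ∀ z ∈ closure D, ‖g z‖ ≤ M := fun z hz =>
    closure_minimal hM (isClosed_le hg.continuous.norm continuous_const) hz
  obtain ⟨δ, hδ, hball⟩ := Metric.isOpen_iff.1
    (isOpen_lt hg.continuous.norm continuous_const : IsOpen {z | ‖g z‖ < r}) a ha
  have hdist : ∀ z ∈ closure D, δ ≤ ‖z - a‖ := by
    have hcl : IsClosed {z : ℂ | δ ≤ ‖z - a‖} :=
      isClosed_le continuous_const (continuous_id.sub continuous_const).norm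
    refine fun y hy => closure_minimal (t := {z : ℂ | δ ≤ ‖z - a‖}) (fun z hz => ?_) hcl hy
    change δ ≤ ‖z - a‖
    by_contra! h
    have h1 : ‖g z‖ < r := hball (mem_ball_iff_norm.2 h)
    have h2 : z ∈ {z | r < ‖g z‖} := connectedComponentIn_subset _ _ hz
    exact lt_asymm h1 h2
  have key : ∀ (m : ℕ) (ρ : ℝ), ‖z₀ - a‖ < ρ →
      ‖g z₀‖ ^ m / ‖z₀ - a‖ ≤ r ^ m / δ + M ^ m / ρ := by
    intro m ρ hρ
    have hρ0 : 0 < ρ := (norm_nonneg _).trans_lt hρ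
    have hsub : closure (D ∩ Metric.ball a ρ) ⊆ closure D := closure_mono Set.inter_subset_left
    have hne : ∀ z ∈ closure D, z - a ≠ 0 := fun z hz =>
      norm_pos_iff.1 (hδ.trans_le (hdist z hz))
    have hd : DiffContOnCl ℂ (fun z => g z ^ m / (z - a)) (D ∩ Metric.ball a ρ) := by
      refine DifferentiableOn.diffContOnCl fun z hz => ?_
      exact (((hg z).pow m).div (by fun_prop) (hne z (hsub hz))).differentiableWithinAt
    have := Complex.norm_le_of_forall_mem_frontier_norm_le
      (Metric.isBounded_ball.subset Set.inter_subset_right) hd (C := r ^ m / δ + M ^ m / ρ) ?_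
      (subset_closure ⟨hz₀D, mem_ball_iff_norm.2 hρ⟩)
    · simpa only [norm_div, norm_pow] using this
    · intro z hz
      have hzcl := hsub (frontier_subset_closure hz)
      have hzδ := hdist z hzcl
      rw [norm_div, norm_pow]
      rcases frontier_inter_subset _ _ hz with h | h
      · have : ‖g z‖ ≤ r := norm_le_of_mem_frontier_connectedComponentIn hg.continuous h.1
        refine le_add_of_le_of_nonneg ?_ (by positivity)
        gcongr
      · have hzρ : ‖z - a‖ = ρ := mem_sphere_iff_norm.1 (Metric.frontier_ball_subset_sphere h.2)
        refine le_add_of_nonneg_of_le (by positivity) ?_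
        rw [hzρ]
        gcongr
        exact hMcl z hzcl
  have hpos : 0 < ‖z₀ - a‖ := hδ.trans_le (hdist z₀ (subset_closure hz₀D))
  have key2 : ∀ m : ℕ, ‖g z₀‖ ^ m / ‖z₀ - a‖ ≤ r ^ m / δ := by
    intro m
    have hlim : Tendsto (fun ρ : ℝ => r ^ m / δ + M ^ m / ρ) atTop (𝓝 (r ^ m / δ + 0)) :=
      tendsto_const_nhds.add (tendsto_id.const_div_atTop _)
    rw [add_zero] at hlim
    exact ge_of_tendsto hlim ((eventually_gt_atTop _).mono fun ρ => key m ρ)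
  obtain ⟨m, hm⟩ := pow_unbounded_of_one_lt (‖z₀ - a‖ / δ) ((one_lt_div hr).2 hz₀)
  have h := key2 m
  rw [div_pow, div_lt_div_iff₀ hδ (by positivity)] at hm
  rw [div_le_div_iff₀ hpos hδ] at h
  linarith [mul_comm (r ^ m) ‖z₀ - a‖]

theorem exists_lt_norm {g : ℂ → ℂ} (hg : Differentiable ℂ g) (hne : ∃ z w, g z ≠ g w) (M : ℝ) :
    ∃ z, M < ‖g z‖ := by
  by_contra! hM
  obtain ⟨z, w, hzw⟩ := hne
  refine hzw (hg.apply_eq_apply_of_bounded (isBounded_iff_forall_norm_le.2 ⟨M, ?_⟩) z w)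
  rintro _ ⟨z, rfl⟩
  exact hM z

/-- **Iversen's theorem**: every nonconstant entire function tends to infinity along some path. -/
theorem exists_path_tendsto_norm_atTop {g : ℂ → ℂ} (hg : Differentiable ℂ g)
    (hne : ∃ z w, g z ≠ g w) :
    ∃ γ : ℝ → ℂ, Continuous γ ∧ Tendsto (fun t => ‖g (γ t)‖) atTop atTop := by
  let r : ℕ → ℝ := fun n => ‖g 0‖ + 1 + n
  have h0r : ∀ n, ‖g 0‖ < r n := fun n => by
    have := n.cast_nonneg (α := ℝ)
    simp only [r]
    linarith
  have hstep : ∀ (n : ℕ) (z : ℂ), ∃ w, r n < ‖g z‖ →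
      w ∈ connectedComponentIn {z | r n < ‖g z‖} z ∧ r (n + 1) < ‖g w‖ := by
    intro n z
    by_cases hz : r n < ‖g z‖
    · obtain ⟨w, hw⟩ := exists_lt_norm_of_mem_connectedComponentIn hg (h0r n) hz (r (n + 1))
      exact ⟨w, fun _ => hw⟩
    · exact ⟨z, fun h => absurd h hz⟩
  choose next hnext using hstep
  obtain ⟨z₀, hz₀⟩ := exists_lt_norm hg hne (r 0)
  let z : ℕ → ℂ := fun n => Nat.rec z₀ next n
  have hz : ∀ n, r n < ‖g (z n)‖ := by
    intro n
    induction n with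
    | zero => exact hz₀
    | succ n ih => exact (hnext n (z n) ih).2
  have hjoin : ∀ n, JoinedIn {z | r n < ‖g z‖} (z n) (z (n + 1)) := by
    intro n
    have hS : IsOpen {z | r n < ‖g z‖} := isOpen_lt continuous_const hg.continuous.norm
    have hconn : IsConnected (connectedComponentIn {z | r n < ‖g z‖} (z n)) :=
      isConnected_connectedComponentIn_iff.2 (hz n)
    exact ((hS.connectedComponentIn.isConnected_iff_isPathConnected.1 hconn).joinedIn _
      (mem_connectedComponentIn (hz n)) _ (hnext n (z n) (hz n)).1).mono
        (connectedComponentIn_subset _ _)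
  obtain ⟨γ, hγ, hγr⟩ := exists_continuous_concat fun n => (hjoin n).somePath
  refine ⟨γ, hγ, tendsto_atTop_mono' _ ?_ (tendsto_atTop_add_const_right _ (‖g 0‖) tendsto_id)⟩
  filter_upwards [eventually_ge_atTop 0] with t ht
  obtain ⟨s, hs⟩ := hγr t ht
  have h1 : r ⌊t⌋₊ < ‖g (γ t)‖ := hs ▸ (hjoin ⌊t⌋₊).somePath_mem s
  have h2 := Nat.lt_floor_add_one t
  simp only [r] at h1
  simp only [id]
  linarith

/-- A nonconstant entire function without zeros has the asymptotic value `0`. -/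
theorem exists_path_tendsto_zero {F : ℂ → ℂ} (hF : Differentiable ℂ F) (h0 : ∀ z, F z ≠ 0)
    (hne : ∃ z w, F z ≠ F w) :
    ∃ γ : ℝ → ℂ, Continuous γ ∧ Tendsto γ atTop (cocompact ℂ) ∧
      Tendsto (fun t => F (γ t)) atTop (𝓝 0) := by
  have hG : Differentiable ℂ fun z => (F z)⁻¹ := hF.inv h0
  obtain ⟨γ, hγ, hlim⟩ := exists_path_tendsto_norm_atTop hG
    (by simpa only [ne_eq, inv_inj] using hne)
  refine ⟨γ, hγ, ?_, ?_⟩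
  · rw [(hasBasis_cocompact).tendsto_right_iff]
    intro K hK
    obtain ⟨C, hC⟩ := hK.exists_bound_of_continuousOn hG.continuous.continuousOn
    filter_upwards [hlim.eventually_gt_atTop C] with t ht hmem
    exact (hC _ hmem).not_gt ht
  · rw [tendsto_zero_iff_norm_tendsto_zero]
    refine hlim.inv_tendsto_atTop.congr fun t => ?_
    simp

/-! ### Logarithms and bounds for holomorphic functions on discs -/

/-- A zero-free holomorphic function on a disc has a holomorphic logarithm there, with a
prescribed value at the centre. -/
theorem exists_differentiableOn_exp_eq {g : ℂ → ℂ} {x : ℂ} {R : ℝ} (hR : 0 < R)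
    (hg : DifferentiableOn ℂ g (Metric.ball x R)) (h0 : ∀ z ∈ Metric.ball x R, g z ≠ 0)
    {l : ℂ} (hl : Complex.exp l = g x) :
    ∃ L : ℂ → ℂ, DifferentiableOn ℂ L (Metric.ball x R) ∧ L x = l ∧
      ∀ z ∈ Metric.ball x R, Complex.exp (L z) = g z := by
  obtain ⟨P, hP⟩ := ((hg.deriv Metric.isOpen_ball).div hg h0).isExactOn_ball
  have hx : x ∈ Metric.ball x R := Metric.mem_ball_self hR
  let Q : ℂ → ℂ := fun z => Complex.exp (P z - P x + l) / g z
  have hgd : ∀ z ∈ Metric.ball x R, HasDerivAt g (deriv g z) z := fun z hz =>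
    ((hg z hz).differentiableAt (Metric.isOpen_ball.mem_nhds hz)).hasDerivAt
  have hQ : ∀ z ∈ Metric.ball x R, HasDerivAt Q 0 z := by
    intro z hz
    have h1 : HasDerivAt (fun z => P z - P x + l) (deriv g z / g z) z :=
      ((hP z hz).sub_const _).add_const _
    have := h1.cexp.div (hgd z hz) (h0 z hz)
    convert! this using 1
    have := h0 z hz
    field_simp
    ring
  have hconst : ∀ z ∈ Metric.ball x R, Q z = Q x := fun z hz =>
    (convex_ball x R).is_const_of_fderivWithin_eq_zero (𝕜 := ℂ)
      (fun z hz => (hQ z hz).differentiableAt.differentiableWithinAt)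
      (fun z hz => by
        rw [fderivWithin_of_isOpen Metric.isOpen_ball hz]
        simpa using (hQ z hz).hasFDerivAt.fderiv) hz hx
  refine ⟨fun z => P z - P x + l, fun z hz => ?_, by simp, fun z hz => ?_⟩
  · exact (((hP z hz).sub_const _).add_const _).differentiableAt.differentiableWithinAt
  · have h1 := hconst z hz
    have h2 : Q x = 1 := by simp [Q, hl, h0 x hx]
    rw [h2] at h1
    exact (div_eq_one_iff_eq (h0 z hz)).1 h1

theorem eqOn_of_exp_eqOn {s : Set ℝ} (hs : IsPreconnected s) {u v : ℝ → ℂ} (hu : ContinuousOn u s)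
    (hv : ContinuousOn v s) (h : ∀ t ∈ s, Complex.exp (u t) = Complex.exp (v t)) {a : ℝ}
    (ha : a ∈ s) (hav : u a = v a) : Set.EqOn u v s := by
  have h' : ∀ t ∈ s, (⟨_, (u t).exp_ne_zero⟩ : {z : ℂ // z ≠ 0}) = ⟨_, (v t).exp_ne_zero⟩ :=
    fun t ht => Subtype.ext (h t ht)
  exact Complex.isCoveringMap_exp.eqOn_of_comp_eqOn hs hu hv h' ha hav

/-- A holomorphic function of modulus at least `m` on a disc is bounded on the half-size disc in
terms of `m` and a bound at the centre: the Borel–Carathéodory inequality for its logarithm. -/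
theorem norm_le_of_le_norm_of_norm_center_le {ψ : ℂ → ℂ} {x : ℂ} {R m C : ℝ} (hR : 0 < R)
    (hm : 0 < m) (hmC : m < C) (hψ : DifferentiableOn ℂ ψ (Metric.ball x R))
    (hlow : ∀ z ∈ Metric.ball x R, m ≤ ‖ψ z‖) (hC : ‖ψ x‖ ≤ C) {z : ℂ} (hz : ‖z - x‖ ≤ R / 2) :
    ‖ψ z‖ ≤ C * Real.exp (2 * Real.log (C / m)) := by
  have hx : x ∈ Metric.ball x R := Metric.mem_ball_self hR
  have h0 : ∀ z ∈ Metric.ball x R, ψ z ≠ 0 := fun z hz =>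
    norm_pos_iff.1 (hm.trans_le (hlow z hz))
  obtain ⟨L, hL, hLx, hLexp⟩ := exists_differentiableOn_exp_eq hR
    (hψ.div_const (ψ x)) (fun z hz => div_ne_zero (h0 z hz) (h0 x hx)) (l := 0)
    (by rw [Complex.exp_zero, div_self (h0 x hx)])
  have hM : 0 < Real.log (C / m) := Real.log_pos ((one_lt_div hm).2 hmC)
  have hmem : ∀ y : ℂ, y ∈ Metric.ball (0 : ℂ) R → y + x ∈ Metric.ball x R := fun y hy => by
    simpa using hy
  have hbc := Complex.borelCaratheodory_zero (f := fun y => -L (y + x)) (z := z - x) hM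
    (R := R) ?_ ?_ hR (by rw [mem_ball_zero_iff]; linarith) (by simp [hLx])
  · simp only [sub_add_cancel, norm_neg] at hbc
    have hpos : 0 < R - ‖z - x‖ := by linarith
    have h1 : ‖L z‖ ≤ 2 * Real.log (C / m) := by
      refine hbc.trans ?_
      rw [div_le_iff₀ hpos]
      have : ‖z - x‖ ≤ R - ‖z - x‖ := by linarith
      gcongr
    have hzb : z ∈ Metric.ball x R := by rw [mem_ball_iff_norm]; linarith
    have h2 : ψ z = ψ x * Complex.exp (L z) := by
      rw [hLexp z hzb, mul_div_cancel₀ _ (h0 x hx)]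
    rw [h2, norm_mul, Complex.norm_exp]
    have hC0 : 0 ≤ C := (norm_nonneg _).trans hC
    have h3 : (L z).re ≤ 2 * Real.log (C / m) := (Complex.re_le_norm _).trans h1
    gcongr
  · refine (hL.comp (by fun_prop) hmem).neg
  · intro y hy
    have hyx := hmem y hy
    have h1 : Real.exp (L (y + x)).re = ‖ψ (y + x)‖ / ‖ψ x‖ := by
      rw [← Complex.norm_exp, hLexp _ hyx, norm_div]
    have h2 : m / C ≤ Real.exp (L (y + x)).re := by
      rw [h1]
      have := hm.trans_le (hlow x hx)
      have := hlow _ hyx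
      gcongr
    have h4 : Real.log (m / C) = -Real.log (C / m) := by rw [← Real.log_inv, inv_div]
    have h5 := Real.log_le_log (by have := hm.trans hmC; positivity) h2
    rw [Real.log_exp, h4] at h5
    change (-L (y + x)).re ≤ _
    rw [Complex.neg_re]
    linarith

/-- A holomorphic function that is uniformly close to the identity on a disc takes all values
near the centre. -/
theorem exists_eq_of_norm_sub_id_le {h : ℂ → ℂ} {p q : ℂ} {δ η : ℝ} (hδ : 0 < δ)
    (hh : Differentiable ℂ h) (hη : 8 * η ≤ δ)
    (hid : ∀ z ∈ Metric.closedBall p δ, ‖h z - z‖ ≤ η) (hq : ‖q - p‖ < δ / 4) :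
    ∃ z ∈ Metric.closedBall p δ, h z = q := by
  have hp := hid p (Metric.mem_closedBall_self hδ.le)
  have hsphere : ∀ z ∈ Metric.sphere p δ, 3 / 4 * δ ≤ ‖h z - h p‖ := by
    intro z hz
    have h1 := hid z (Metric.sphere_subset_closedBall hz)
    have h2 : ‖z - p‖ = δ := mem_sphere_iff_norm.1 hz
    have h3 : ‖z - p‖ ≤ ‖h z - h p‖ + ‖h z - z‖ + ‖h p - p‖ := by
      calc ‖z - p‖ = ‖(h z - h p) - (h z - z) + (h p - p)‖ := by congr 1; ring
        _ ≤ _ := (norm_add_le _ _).trans (by gcongr; exact norm_sub_le _ _)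
    linarith
  have hfreq : ∃ᶠ z in 𝓝 p, h z ≠ h p := by
    intro hev
    have hev' : ∀ᶠ z in 𝓝 p, h z = h p := hev.mono fun z hz => not_not.1 hz
    have heq := (hh.differentiableOn (s := Set.univ)).analyticOnNhd isOpen_univ
      |>.eq_of_eventuallyEq (analyticOnNhd_const (v := h p)) (z₀ := p) hev'
    obtain ⟨z, hz⟩ := (NormedSpace.sphere_nonempty.2 hδ.le : (Metric.sphere p δ).Nonempty)
    have := hsphere z hz
    rw [heq, sub_self, norm_zero] at this
    linarith
  refine hh.diffContOnCl.ball_subset_image_closedBall hδ hsphere hfreq ?_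
  rw [mem_ball_iff_norm]
  have : ‖q - h p‖ ≤ ‖q - p‖ + ‖h p - p‖ := by
    rw [norm_sub_rev (h p)]; exact norm_sub_le_norm_sub_add_norm_sub _ _ _
  linarith

/-! ### Singular values of an infinite exponential tower -/

section Tower

variable {μ : ℕ → ℂ} {F : ℕ → ℂ → ℂ}

theorem ne_zero_of_tower (hμ : ∀ n, μ n ≠ 0) (hF : ∀ n z, F n z = μ n * Complex.exp (F (n + 1) z))
    (n : ℕ) (z : ℂ) : F n z ≠ 0 := by
  rw [hF]
  exact mul_ne_zero (hμ n) (Complex.exp_ne_zero _)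

/-- If a disc contains none of the points `expTower μ n 0`, then a germ of the inverse function of
`F 0` on it can be followed through the tower, as holomorphic functions `g n` with
`g n ∘ F 0 = F n`, along any path mapped into the disc. -/
theorem exists_inverse_branches (hμ : ∀ n, μ n ≠ 0) (hFd : ∀ n, Differentiable ℂ (F n))
    (hF : ∀ n z, F n z = μ n * Complex.exp (F (n + 1) z)) {γ : ℝ → ℂ} {t₀ R : ℝ} (hR : 0 < R)
    (hγ : ContinuousOn γ (Set.Ici t₀))
    (hdisc : ∀ n, expTower μ n 0 ∉ Metric.ball (F 0 (γ t₀)) R)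
    (hγdisc : ∀ t, t₀ ≤ t → F 0 (γ t) ∈ Metric.ball (F 0 (γ t₀)) R) (n : ℕ) :
    ∃ g : ℂ → ℂ, DifferentiableOn ℂ g (Metric.ball (F 0 (γ t₀)) R) ∧
      (∀ ζ ∈ Metric.ball (F 0 (γ t₀)) R, expTower μ n (g ζ) = ζ) ∧
      ∀ t, t₀ ≤ t → g (F 0 (γ t)) = F n (γ t) := by
  induction n with
  | zero => exact ⟨id, differentiableOn_id, fun ζ _ => rfl, fun t _ => rfl⟩
  | succ n ih =>
    obtain ⟨g, hgd, hg, hgF⟩ := ih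
    have hg0 : ∀ ζ ∈ Metric.ball (F 0 (γ t₀)) R, g ζ / μ n ≠ 0 := by
      intro ζ hζ
      refine div_ne_zero (fun h => hdisc n ?_) (hμ n)
      rw [← h, hg ζ hζ]
      exact hζ
    have hexp : ∀ t, t₀ ≤ t → Complex.exp (F (n + 1) (γ t)) = g (F 0 (γ t)) / μ n := by
      intro t ht
      rw [hgF t ht, hF n, mul_div_cancel_left₀ _ (hμ n)]
    obtain ⟨L, hLd, hL0, hL⟩ := exists_differentiableOn_exp_eq hR (hgd.div_const (μ n)) hg0
      (hexp t₀ le_rfl)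
    refine ⟨L, hLd, fun ζ hζ => ?_, ?_⟩
    · change expTower μ n (μ n * Complex.exp (L ζ)) = ζ
      rw [hL ζ hζ, mul_div_cancel₀ _ (hμ n), hg ζ hζ]
    · refine eqOn_of_exp_eqOn isPreconnected_Ici
        (hLd.continuousOn.comp ((hFd 0).continuous.comp_continuousOn hγ) hγdisc)
        ((hFd (n + 1)).continuous.comp_continuousOn hγ) (fun t ht => ?_)
        (Set.self_mem_Ici) hL0
      rw [hL _ (hγdisc t ht), hexp t ht]

/-- An asymptotic value of an infinite tower lies in the closure of the points `expTower μ n 0`.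
Otherwise the inverse branches `φ n = (g n - b n) / c n` are defined on one common disc, where they
omit a fixed disc and are therefore uniformly bounded; since `φ n ∘ F 0` tends to the identity,
the path is bounded. -/
theorem mem_of_tendsto_tower (hμ : ∀ n, μ n ≠ 0) (hFd : ∀ n, Differentiable ℂ (F n))
    (hF : ∀ n z, F n z = μ n * Complex.exp (F (n + 1) z)) (hne : ∃ z w, F 0 z ≠ F 0 w)
    {b c : ℕ → ℂ} (hc : ∀ n, c n ≠ 0) {ε : ℝ}
    (haff : ∀ (n : ℕ) (z : ℂ), n ≠ 0 → ‖z‖ ≤ n →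
      ‖F n z - (b n + c n * z)‖ ≤ ‖c n‖ * ε / 2 ^ n)
    {U : Set ℂ} (hU : IsClosed U) (hmem : ∀ n, expTower μ n 0 ∈ U) {γ : ℝ → ℂ}
    (hγ : ContinuousOn γ (Set.Ici 0)) (hγlim : Tendsto γ atTop (cocompact ℂ)) {w : ℂ}
    (hw : Tendsto (fun t => F 0 (γ t)) atTop (𝓝 w)) : w ∈ U := by
  by_contra hwU
  obtain ⟨r, hr, hrU⟩ := Metric.isOpen_iff.1 hU.isOpen_compl w hwU
  obtain ⟨t₀, ht₀, ht₀w⟩ : ∃ t₀, 0 ≤ t₀ ∧ ∀ t, t₀ ≤ t → ‖F 0 (γ t) - w‖ < r / 8 := by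
    have := (hw.eventually (Metric.ball_mem_nhds w (by positivity : 0 < r / 8))).and
      (eventually_ge_atTop 0)
    obtain ⟨t₀, h⟩ := eventually_atTop.1 this
    exact ⟨t₀, (h t₀ le_rfl).2, fun t ht => mem_ball_iff_norm.1 (h t ht).1⟩
  set ζ₀ := F 0 (γ t₀) with hζ₀
  have hζw := ht₀w t₀ le_rfl
  have hζγ : ∀ t, t₀ ≤ t → ‖F 0 (γ t) - ζ₀‖ ≤ r / 2 / 2 := by
    intro t ht
    have h1 := norm_sub_le_norm_sub_add_norm_sub (F 0 (γ t)) w ζ₀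
    rw [norm_sub_rev w] at h1
    linarith [ht₀w t ht]
  have hr2 : 0 < r / 2 := half_pos hr
  have hdisc : ∀ n, expTower μ n 0 ∉ Metric.ball ζ₀ (r / 2) := by
    intro n hn
    refine hrU (Metric.ball_subset_ball' ?_ hn) (hmem n)
    rw [dist_eq_norm]
    linarith
  have hγdisc : ∀ t, t₀ ≤ t → F 0 (γ t) ∈ Metric.ball ζ₀ (r / 2) := fun t ht => by
    rw [mem_ball_iff_norm]
    linarith [hζγ t ht]
  choose g hgd hg hgF using exists_inverse_branches hμ hFd hF hr2
    (hγ.mono (Set.Ici_subset_Ici.2 ht₀)) hdisc hγdisc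
  -- By Liouville's theorem `F 0` maps some disc about a point `p` into the complement of
  -- `ball ζ₀ (r / 2)`.
  obtain ⟨p, hp⟩ := exists_lt_norm (hFd 0) hne (‖ζ₀‖ + r / 2)
  obtain ⟨δ, hδ, hδp⟩ : ∃ δ > 0, ∀ z ∈ Metric.closedBall p δ, F 0 z ∉ Metric.ball ζ₀ (r / 2) := by
    obtain ⟨δ, hδ, hsub⟩ := Metric.nhds_basis_closedBall.mem_iff.1
      ((isOpen_lt continuous_const (hFd 0).continuous.norm).mem_nhds hp)
    refine ⟨δ, hδ, fun z hz hmem => ?_⟩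
    have h1 : ‖ζ₀‖ + r / 2 < ‖F 0 z‖ := hsub hz
    have h2 := norm_le_norm_add_norm_sub ζ₀ (F 0 z)
    rw [mem_ball_iff_norm, norm_sub_rev] at hmem
    linarith
  let h : ℕ → ℂ → ℂ := fun n z => (F n z - b n) / c n
  have hid : ∀ (n : ℕ) (z : ℂ), n ≠ 0 → ‖z‖ ≤ n → ‖h n z - z‖ ≤ ε / 2 ^ n := by
    intro n z hn hz
    have h1 : h n z - z = (F n z - (b n + c n * z)) / c n := by
      have := hc n
      simp only [h]
      field_simp
      ring
    have hcn : 0 < ‖c n‖ := norm_pos_iff.2 (hc n)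
    rw [h1, norm_div, div_le_iff₀ hcn]
    exact (haff n z hn hz).trans_eq (by ring)
  have hsmall : Tendsto (fun n : ℕ => ε / 2 ^ n) atTop (𝓝 0) :=
    tendsto_const_nhds.div_atTop (tendsto_pow_atTop_atTop_of_one_lt one_lt_two)
  have hbig : ∀ C : ℝ, ∀ᶠ n : ℕ in atTop, C ≤ n := fun C =>
    tendsto_natCast_atTop_atTop.eventually_ge_atTop C
  have hmδ : 0 < δ / 4 := by positivity
  set C : ℝ := ‖γ t₀ - p‖ + 1 + δ with hC
  have hCm : δ / 4 < C := by have := norm_nonneg (γ t₀ - p); linarith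
  have hbound : ∀ t, t₀ ≤ t →
      ‖γ t - p‖ ≤ C * Real.exp (2 * Real.log (C / (δ / 4))) + 1 := by
    intro t ht
    obtain ⟨n, hn0, hn1, hnδ, hnp, hnγ₀, hnγ⟩ := ((eventually_ne_atTop 0).and
      ((hsmall.eventually (gt_mem_nhds one_pos)).and
      ((hsmall.eventually (gt_mem_nhds (by positivity : 0 < δ / 8))).and
      ((hbig (‖p‖ + δ)).and ((hbig ‖γ t₀‖).and (hbig ‖γ t‖)))))).exists
    have hψlow : ∀ ζ ∈ Metric.ball ζ₀ (r / 2), δ / 4 ≤ ‖(g n ζ - b n) / c n - p‖ := by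
      intro ζ hζ
      by_contra! hlt
      have hhd : Differentiable ℂ (h n) := ((hFd n).sub_const _).div_const _
      obtain ⟨z, hz, hzq⟩ := exists_eq_of_norm_sub_id_le hδ hhd (η := ε / 2 ^ n) (by linarith)
        (fun z hz => hid n z hn0 (by
          have h1 := norm_le_norm_add_norm_sub p z
          rw [mem_closedBall_iff_norm, norm_sub_rev] at hz
          linarith)) hlt
      have h1 : F n z = g n ζ := by
        have := hc n
        simp only [h] at hzq
        field_simp at hzq
        simpa using hzq
      refine hδp z hz ?_
      rw [← expTower_eq_of_recursion (fun n => hF n z) n, h1, hg n ζ hζ]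
      exact hζ
    have hγh : ∀ s, t₀ ≤ s → (g n (F 0 (γ s)) - b n) / c n - p = h n (γ s) - γ s + (γ s - p) := by
      intro s hs
      rw [hgF n s hs]
      ring
    have h1 := norm_le_of_le_norm_of_norm_center_le hr2 hmδ hCm
      (((hgd n).sub_const (b n)).div_const (c n) |>.sub_const p) hψlow ?_ (hζγ t ht)
    · rw [hγh t ht] at h1
      have h2 := norm_sub_le (h n (γ t) - γ t + (γ t - p)) (h n (γ t) - γ t)
      rw [add_sub_cancel_left] at h2
      have h3 := hid n (γ t) hn0 hnγ
      linarith
    · rw [hγh t₀ le_rfl]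
      have h2 := norm_add_le (h n (γ t₀) - γ t₀) (γ t₀ - p)
      have h3 := hid n (γ t₀) hn0 hnγ₀
      linarith
  have hout := hγlim.eventually (isCompact_closedBall p
    (C * Real.exp (2 * Real.log (C / (δ / 4))) + 1)).compl_mem_cocompact
  obtain ⟨t, ht, htt⟩ := (hout.and (eventually_ge_atTop t₀)).exists
  exact ht (mem_closedBall_iff_norm.2 (hbound t htt))

/-- The derivative at `z` of the first function of the tower vanishes only if the derivatives of
all the functions do. -/
theorem deriv_tower_eq_zero (hμ : ∀ n, μ n ≠ 0) (hFd : ∀ n, Differentiable ℂ (F n))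
    (hF : ∀ n z, F n z = μ n * Complex.exp (F (n + 1) z)) {z : ℂ} (h0 : deriv (F 0) z = 0) (n : ℕ) :
    deriv (F n) z = 0 := by
  induction n with
  | zero => exact h0
  | succ n ih =>
    have h1 : HasDerivAt (F n) (μ n * (Complex.exp (F (n + 1) z) * deriv (F (n + 1)) z)) z := by
      rw [show F n = fun z => μ n * Complex.exp (F (n + 1) z) from funext (hF n)]
      exact ((hFd (n + 1) z).hasDerivAt.cexp).const_mul _
    rw [h1.deriv] at ih
    simpa [hμ n] using ih

theorem deriv_tower_ne_zero (hμ : ∀ n, μ n ≠ 0) (hFd : ∀ n, Differentiable ℂ (F n))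
    (hF : ∀ n z, F n z = μ n * Complex.exp (F (n + 1) z)) {b c : ℕ → ℂ} (hc : ∀ n, c n ≠ 0) {ε : ℝ}
    (haff : ∀ (n : ℕ) (z : ℂ), n ≠ 0 → ‖z‖ ≤ n →
      ‖F n z - (b n + c n * z)‖ ≤ ‖c n‖ * ε / 2 ^ n) (z : ℂ) :
    deriv (F 0) z ≠ 0 := by
  intro h0
  have hsmall : Tendsto (fun n : ℕ => ε / 2 ^ n) atTop (𝓝 0) :=
    tendsto_const_nhds.div_atTop (tendsto_pow_atTop_atTop_of_one_lt one_lt_two)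
  obtain ⟨n, hn0, hn1, hnz⟩ := ((eventually_ne_atTop 0).and
    ((hsmall.eventually (gt_mem_nhds one_pos)).and
    (tendsto_natCast_atTop_atTop.eventually_ge_atTop (‖z‖ + 1)))).exists
  have hcn : 0 < ‖c n‖ := norm_pos_iff.2 (hc n)
  have hd : Differentiable ℂ fun z => F n z - (b n + c n * z) := (hFd n).sub (by fun_prop)
  have hcauchy := Complex.norm_deriv_le_of_forall_mem_sphere_norm_le one_pos
    (hd.diffContOnCl (s := Metric.ball z 1)) (C := ‖c n‖ * ε / 2 ^ n) fun y hy => by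
      refine haff n y hn0 ?_
      have h1 := norm_le_norm_add_norm_sub z y
      rw [norm_sub_rev, mem_sphere_iff_norm.1 hy] at h1
      linarith
  have hderiv : deriv (fun z => F n z - (b n + c n * z)) z = -c n := by
    have h1 : HasDerivAt (fun z => F n z - (b n + c n * z)) (0 - c n * 1) z := by
      have := (hFd n z).hasDerivAt
      rw [deriv_tower_eq_zero hμ hFd hF h0 n] at this
      exact this.sub (((hasDerivAt_id z).const_mul (c n)).const_add (b n))
    rw [h1.deriv]
    ring
  rw [hderiv, norm_neg, div_one, mul_div_assoc] at hcauchy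
  have := (mul_lt_iff_lt_one_right hcn).2 hn1
  linarith

/-- The points `expTower μ n 0` are asymptotic values of the tower: `F n` is zero-free, so it has
the asymptotic value `0`. -/
theorem expTower_zero_mem_asymptoticValues (hμ : ∀ n, μ n ≠ 0) (hFd : ∀ n, Differentiable ℂ (F n))
    (hF : ∀ n z, F n z = μ n * Complex.exp (F (n + 1) z)) (hne : ∃ z w, F 0 z ≠ F 0 w) (n : ℕ) :
    expTower μ n 0 ∈ asymptoticValues (F 0) := by
  have hG : ∀ z, expTower μ n (F n z) = F 0 z := fun z =>
    expTower_eq_of_recursion (fun n => hF n z) n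
  obtain ⟨x, y, hxy⟩ := hne
  obtain ⟨γ, hγ, hγlim, hlim⟩ := exists_path_tendsto_zero (hFd n) (ne_zero_of_tower hμ hF n)
    ⟨x, y, fun h => hxy (by rw [← hG, ← hG, h])⟩
  refine ⟨γ, hγ.continuousOn, hγlim, ?_⟩
  exact (((differentiable_expTower μ n).continuous.tendsto 0).comp hlim).congr fun t => hG (γ t)

end Tower

/-! ### Choice of the multipliers -/

theorem locallyUnivalent_of_deriv_ne_zero {f : ℂ → ℂ} (hf : Differentiable ℂ f)
    (h : ∀ z, deriv f z ≠ 0) : LocallyUnivalent f := by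
  intro z
  have hs : HasStrictFDerivAt f _ z :=
    ((hf.contDiff (n := 1)).contDiffAt.hasStrictDerivAt one_ne_zero).hasStrictFDerivAt_equiv (h z)
  refine ⟨(hs.toOpenPartialHomeomorph f).source, (hs.toOpenPartialHomeomorph f).open_source.mem_nhds
    hs.mem_toOpenPartialHomeomorph_source, ?_⟩
  simpa using (hs.toOpenPartialHomeomorph f).injOn

theorem theorem1 (U : Set ℂ) (hU : IsClosed U) (h0 : (0 : ℂ) ∈ U) (h1 : ∃ a ∈ U, a ≠ 0)
    (K : Set ℂ) (hK : IsCompact K) (ε : ℝ) (hε : 0 < ε) :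
    ∃ f : ℂ → ℂ, Differentiable ℂ f ∧ LocallyUnivalent f ∧ f ∈ classE ∧
      singularValues f = U ∧ ∀ z ∈ K, ‖f z - Complex.exp z‖ ≤ ε := by
  obtain ⟨a, haU, ha0⟩ := h1
  have : Nonempty (U \ {0} : Set ℂ) := ⟨⟨a, haU, ha0⟩⟩
  let d : ℕ → ℂ := fun n => (TopologicalSpace.denseSeq (U \ {0} : Set ℂ) n : ℂ)
  have hdU : ∀ n, d n ∈ U \ {0} := fun n => (TopologicalSpace.denseSeq (U \ {0} : Set ℂ) n).2
  have hdense : U \ {0} ⊆ closure (Set.range d) := by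
    intro u hu
    have h := image_closure_subset_closure_image (continuous_subtype_val (p := (· ∈ U \ {0})))
      (Set.mem_image_of_mem _ ((TopologicalSpace.denseRange_denseSeq (U \ {0} : Set ℂ)) ⟨u, hu⟩))
    rwa [← Set.range_comp] at h
  obtain ⟨μ, hμ, hμd⟩ := exists_expTower_eq d fun n => (hdU n).2
  have hsucc : ∀ n, expTower μ (n + 1) 0 = d n := fun n => by
    rw [← hμd n, expTower, Complex.exp_zero, mul_one]
  have hmem : ∀ n, expTower μ n 0 ∈ U := by
    intro n
    cases n with
    | zero => exact h0
    | succ n => rw [hsucc]; exact (hdU n).1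
  obtain ⟨R, hR⟩ := hK.isBounded.exists_norm_le
  obtain ⟨F, b, c, hFd, hF, happ, hc, haff⟩ :=
    exists_tower μ hμ (max R 0) ε (le_max_right _ _) hε
  have hderiv := deriv_tower_ne_zero hμ hFd hF hc haff
  have hne : ∃ z w, F 0 z ≠ F 0 w := by
    by_contra! h
    refine hderiv 0 ?_
    rw [show F 0 = fun _ => F 0 0 from funext fun z => h z 0, deriv_const]
  -- `classE` numbers the multipliers from `1`, so `lam (n + 1) = μ n`.
  refine ⟨F 0, hFd 0, locallyUnivalent_of_deriv_ne_zero (hFd 0) hderiv,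
    ⟨F, fun n => μ (n - 1), rfl, hFd, hF⟩, ?_,
    fun z hz => happ z ((hR z hz).trans (le_max_left _ _))⟩
  have hCV : criticalValues (F 0) = ∅ :=
    Set.eq_empty_of_forall_notMem fun w ⟨z, hz, _⟩ => hderiv z hz
  have hAV := expTower_zero_mem_asymptoticValues hμ hFd hF hne
  rw [singularValues, hCV, Set.union_empty]
  refine (closure_minimal ?_ hU).antisymm fun u hu => ?_
  · rintro w ⟨γ, hγ, hγlim, hw⟩
    exact mem_of_tendsto_tower hμ hFd hF hne hc haff hU hmem hγ hγlim hw
  · by_cases hu0 : u = 0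
    · rw [hu0]
      exact subset_closure (hAV 0)
    · refine closure_mono ?_ (hdense ⟨hu, hu0⟩)
      rintro _ ⟨n, rfl⟩
      rw [← hsucc]
      exact hAV (n + 1)
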